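/- Let $n\ge 4$, $M\ge 2$, $\sigma>0$, and observe $Y=f+\varepsilon\in\mathbb{R}^n$, where $f\in\mathbb{R}^n$ and $\varepsilon_1,\dots,\varepsilon_n$ are independent centered Gaussian variables with variance $\sigma^2$ ($f$ and $\sigma$ are unknown). Let $\phi_1,\dots,\phi_M\in\mathbb{R}^n$ be (non-random) preliminary estimators, $\|\cdot\|$ the Euclidean norm, $\Lambda=\{\lambda\in[0,\infty)^M:\sum_j\lambda_j=1\}$, $f_\lambda=\sum_j\lambda_j\phi_j$, $\mathbb{F}=\{f_\lambda:\lambda\in\Lambda\}$ (the convex hull of the $\phi_j$), and $L=\max_j\|\phi_j\|/(\sigma\sqrt n)$. Assume $$(\mathrm{HM})\qquad 2\le\sqrt n\,L\le M\le e^{-1}\min\{\sqrt n\,L\,e^{nL^2},\,e^{\sqrt n/(2L)}\}.$$ For $\varnothing\ne m\subset\{1,\dots,M\}$ let $S_m$ be the linear span of the $\phi_j$, $j\in m$, $\Pi_{S_m}$ the orthogonal projection onto $S_m$, and $\Delta(S_m)=|m|+\log\binom{M}{|m|}$. Consider the models $S_m$ (indexed by $m$) with $1\le |m|\le n/(2\log(eM))$.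 For such a model $S$ let $\mathrm{pen}_\Delta(S)\ge 0$ be the solution of $$\mathbb{E}\Big[\Big(U-\frac{\mathrm{pen}_\Delta(S)}{n-\dim S}V\Big)_+\Big]=e^{-\Delta(S)},$$ where $U,V$ are independent $\chi^2$ variables with $\dim S+1$ and $n-\dim S-1$ degrees of freedom, and put $\mathrm{pen}(S)=1.1\,\mathrm{pen}_\Delta(S)$ and $\widehat\sigma_S^2=\|Y-\Pi_SY\|^2/(n-\dim S)$. For $g\in\mathbb{R}^n$ define $$\mathrm{crit}(g)=\min_{S}\Big[\|Y-\Pi_Sg\|^2+\tfrac12\|g-\Pi_Sg\|^2+\mathrm{pen}(S)\,\widehat\sigma_S^2\Big],$$ the minimum being over the models above. For every value of $Y$ the map $\lambda\mapsto\mathrm{crit}(f_\lambda)$ has a minimizer over $\Lambda$. Let $\widehat\lambda$ be any such minimizer, chosen such that the estimator $\widehat f_{\mathrm{Cv}}=f_{\widehat\lambda}$ is measurable. There exists a universal constant $C>1$ (not depending on $n$, $M$, $\sigma$, $f$, the $\phi_j$ or the choice of $\widehat\lambda$) such that $\|f-\widehat f_{\mathrm{Cv}}\|^2$ is integrable and $$\mathbb{E}\big[\|f-\widehat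 f_{\mathrm{Cv}}\|^2\big]-C\inf_{g\in\mathbb{F}}\|f-g\|^2\le C\sqrt{nL^2\log\!\big(eM/\sqrt{nL^2}\big)}\;\sigma^2 .$$ -/

import Mathlib

open MeasureTheory ProbabilityTheory

namespace ConvexAggregation

noncomputable section

/-- The chi-squared distribution with `k` degrees of freedom: the law of the sum of the squares
of `k` independent standard Gaussian variables. -/
def chiSq (k : ℕ) : Measure ℝ :=
  (Measure.pi fun _ : Fin k => gaussianReal 0 1).map fun z => ∑ i, z i ^ 2

/-- `E[(U - x / (n - D) * V)₊]` for independent chi-squared variables `U` and `V` with `D + 1` and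
`n - D - 1` degrees of freedom (only used for `D ≤ n - 2`). -/
def expectedExcess (n D : ℕ) (x : ℝ) : ℝ :=
  ∫ p : ℝ × ℝ, max (p.1 - x / ((n : ℝ) - D) * p.2) 0 ∂((chiSq (D + 1)).prod (chiSq (n - D - 1)))

/-- `pen_Δ` for a model of dimension `D` in `ℝⁿ` with weight `w`: the nonnegative solution `x` of
`E[(U - x / (n - D) * V)₊] = exp (-w)`. For `D ≤ n - 2` and `w ≥ 0` the set below has exactly one
element, see `existsUnique_penDelta`. -/
def penDelta (n D : ℕ) (w : ℝ) : ℝ :=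
  sInf {x : ℝ | 0 ≤ x ∧ expectedExcess n D x = Real.exp (-w)}

/-- The model `S_m`: the linear span of the `φ j` for `j ∈ m`. -/
def model {n M : ℕ} (φ : Fin M → EuclideanSpace ℝ (Fin n)) (m : Finset (Fin M)) :
    Submodule ℝ (EuclideanSpace ℝ (Fin n)) :=
  Submodule.span ℝ (φ '' (m : Set (Fin M)))

/-- The weight `Δ(S_m) = |m| + log (M choose |m|)`. -/
def weight {M : ℕ} (m : Finset (Fin M)) : ℝ :=
  (m.card : ℝ) + Real.log (M.choose m.card)

/-- The (indices of the) family of models used for convex aggregation: the nonempty `m` with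
`|m| ≤ n / (2 log (eM))`. -/
def modelFamily (n M : ℕ) : Set (Finset (Fin M)) :=
  {m | m.Nonempty ∧ (m.card : ℝ) ≤ (n : ℝ) / (2 * Real.log (Real.exp 1 * M))}

/-- The penalty `pen(S_m) = 1.1 pen_Δ(S_m)`. -/
def penalty {n M : ℕ} (φ : Fin M → EuclideanSpace ℝ (Fin n)) (m : Finset (Fin M)) : ℝ :=
  1.1 * penDelta n (Module.finrank ℝ (model φ m)) (weight m)

/-- The residual variance estimator `‖y - Π_S y‖² / (n - dim S)`. -/
def varEst {n : ℕ} (S : Submodule ℝ (EuclideanSpace ℝ (Fin n)))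
    (y : EuclideanSpace ℝ (Fin n)) : ℝ :=
  ‖y - S.starProjection y‖ ^ 2 / ((n : ℝ) - Module.finrank ℝ S)

/-- The selection criterion `crit_α(g)` with `α = 1/2`, computed from the observation `y`. -/
def crit {n M : ℕ} (φ : Fin M → EuclideanSpace ℝ (Fin n)) (y g : EuclideanSpace ℝ (Fin n)) : ℝ :=
  ⨅ m : modelFamily n M,
    (‖y - (model φ m).starProjection g‖ ^ 2
      + 1 / 2 * ‖g - (model φ m).starProjection g‖ ^ 2
      + penalty φ m * varEst (model φ m) y)

/-- The combination `f_l = ∑ j, l j • φ j`. -/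
def combo {n M : ℕ} (φ : Fin M → EuclideanSpace ℝ (Fin n)) (l : Fin M → ℝ) :
    EuclideanSpace ℝ (Fin n) :=
  ∑ j, l j • φ j

/-- `l` is a minimizer of `l ↦ crit(f_l)` over the weight vectors `l` with nonnegative
coordinates of sum `1`, given the observation `y`. -/
def IsSelected {n M : ℕ} (φ : Fin M → EuclideanSpace ℝ (Fin n)) (y : EuclideanSpace ℝ (Fin n))
    (l : Fin M → ℝ) : Prop :=
  l ∈ stdSimplex ℝ (Fin M) ∧ IsMinOn (fun l' => crit φ y (combo φ l')) (stdSimplex ℝ (Fin M)) l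

/-- The ratio `L = max_j ‖φ_j‖ / (σ √n)`. -/
def ratioL {n M : ℕ} (φ : Fin M → EuclideanSpace ℝ (Fin n)) (σ : ℝ) : ℝ :=
  ⨆ j, ‖φ j‖ / (σ * √(n : ℝ))

/-- Condition (HM):
`2 ≤ √n L ≤ M ≤ e⁻¹ min {√n L exp (n L²), exp (√n / (2L))}`. -/
def CondHM (n M : ℕ) (L : ℝ) : Prop :=
  2 ≤ √(n : ℝ) * L ∧ √(n : ℝ) * L ≤ M ∧
    (M : ℝ) ≤ (Real.exp 1)⁻¹ *
      min (√(n : ℝ) * L * Real.exp (n * L ^ 2)) (Real.exp (√(n : ℝ) / (2 * L)))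

/-- The Gaussian observation `Y = f + ε`. -/
def observation {n : ℕ} {Ω : Type*} (f : EuclideanSpace ℝ (Fin n)) (ε : Fin n → Ω → ℝ) (ω : Ω) :
    EuclideanSpace ℝ (Fin n) :=
  f + WithLp.toLp 2 fun i => ε i ω

lemma measurable_sumSq (k : ℕ) : Measurable fun z : Fin k → ℝ => ∑ i, z i ^ 2 := by
  fun_prop

instance (k : ℕ) : IsProbabilityMeasure (chiSq k) := by
  unfold chiSq
  exact Measure.isProbabilityMeasure_map (measurable_sumSq k).aemeasurable

lemma integrable_sq_gaussian : Integrable (fun z : ℝ => z ^ 2) (gaussianReal 0 1) :=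
  (memLp_id_gaussianReal 2).integrable_sq

lemma integrable_sumSq (k : ℕ) :
    Integrable (fun z : Fin k → ℝ => ∑ i, z i ^ 2) (Measure.pi fun _ => gaussianReal 0 1) :=
  integrable_finsetSum _ fun i _ =>
    integrable_comp_eval (μ := fun _ : Fin k => gaussianReal 0 1) (i := i) integrable_sq_gaussian

lemma integrable_id_chiSq (k : ℕ) : Integrable (fun u : ℝ => u) (chiSq k) := by
  unfold chiSq
  exact (integrable_map_measure (by fun_prop) (measurable_sumSq k).aemeasurable).2 (integrable_sumSq k)

lemma integral_id_chiSq (k : ℕ) : ∫ u, u ∂(chiSq k) = k := by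
  have h1 : ∫ z : ℝ, z ^ 2 ∂(gaussianReal 0 1) = 1 := by
    have := variance_id_gaussianReal (μ := 0) (v := 1)
    rw [variance_eq_integral (by fun_prop)] at this
    simpa using this
  unfold chiSq
  rw [integral_map (measurable_sumSq k).aemeasurable (by fun_prop), integral_finsetSum]
  · have : ∀ i : Fin k, ∫ z : Fin k → ℝ, z i ^ 2 ∂(Measure.pi fun _ => gaussianReal 0 1) = 1 := by
      intro i
      rw [integral_comp_eval (μ := fun _ : Fin k => gaussianReal 0 1) (i := i)
        (f := fun x : ℝ => x ^ 2) (by fun_prop), h1]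
    simp [this]
  · intro i _
    exact integrable_comp_eval (μ := fun _ : Fin k => gaussianReal 0 1) (i := i)
      integrable_sq_gaussian

lemma chiSq_nonneg (k : ℕ) : ∀ᵐ u ∂(chiSq k), 0 ≤ u := by
  unfold chiSq
  rw [ae_map_iff (measurable_sumSq k).aemeasurable measurableSet_Ici]
  exact Filter.Eventually.of_forall fun z => Finset.sum_nonneg fun i _ => sq_nonneg _

lemma chiSq_pos {k : ℕ} (hk : 0 < k) : ∀ᵐ u ∂(chiSq k), 0 < u := by
  have := nullSingletonClass_gaussianReal (μ := 0) (v := 1) one_ne_zero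
  unfold chiSq
  rw [ae_map_iff (measurable_sumSq k).aemeasurable measurableSet_Ioi]
  have h0 : ∀ᵐ x ∂(gaussianReal 0 1), x ≠ 0 := by
    simp only [ae_iff, not_not]
    exact measure_singleton 0
  have := (measurePreserving_eval (fun _ : Fin k => gaussianReal 0 1)
    ⟨0, hk⟩).quasiMeasurePreserving.ae h0
  filter_upwards [this] with z hz
  exact lt_of_lt_of_le (by positivity)
    (Finset.single_le_sum (f := fun i => z i ^ 2) (fun i _ => sq_nonneg _)
      (Finset.mem_univ (⟨0, hk⟩ : Fin k)))

/-- The equation that defines `penDelta` has exactly one nonnegative solution. -/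
theorem existsUnique_penDelta {n D : ℕ} (hD : D + 2 ≤ n) {w : ℝ} (hw : 0 ≤ w) :
    ∃! x : ℝ, 0 ≤ x ∧ expectedExcess n D x = Real.exp (-w) := by
  set μ := (chiSq (D + 1)).prod (chiSq (n - D - 1)) with hμ
  have hc : 0 < (n : ℝ) - D := by
    have : ((D + 2 : ℕ) : ℝ) ≤ n := by exact_mod_cast hD
    push_cast at this; linarith
  set c := (n : ℝ) - D
  have hU : Integrable (fun p : ℝ × ℝ => p.1) μ := (integrable_id_chiSq _).comp_fst _
  have hV : Integrable (fun p : ℝ × ℝ => p.2) μ := (integrable_id_chiSq _).comp_snd _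
  have hU0 : ∀ᵐ p ∂μ, 0 ≤ p.1 := Measure.quasiMeasurePreserving_fst.ae (chiSq_nonneg _)
  have hV0 : ∀ᵐ p ∂μ, 0 < p.2 := Measure.quasiMeasurePreserving_snd.ae (chiSq_pos (by omega))
  have hI : ∀ x : ℝ, Integrable (fun p : ℝ × ℝ => max (p.1 - x / c * p.2) 0) μ :=
    fun x => (hU.sub (hV.const_mul _)).pos_part
  have hcont : ContinuousOn (expectedExcess n D) (Set.Ici 0) := by
    intro x _
    refine continuousWithinAt_of_dominated (bound := fun p => |p.1|) ?_ ?_ hU.abs ?_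
    · exact Filter.Eventually.of_forall fun x => (hI x).aestronglyMeasurable
    · filter_upwards [self_mem_nhdsWithin] with y hy
      filter_upwards [hU0, hV0] with p hp hq
      have : 0 ≤ y / c * p.2 := mul_nonneg (div_nonneg hy hc.le) hq.le
      rw [Real.norm_eq_abs, abs_of_nonneg (le_max_right _ _), abs_of_nonneg hp]
      exact max_le (by linarith) hp
    · refine Filter.Eventually.of_forall fun p => ?_
      exact Continuous.continuousWithinAt (by fun_prop)
  have hlim : Filter.Tendsto (expectedExcess n D) Filter.atTop (nhds 0) := by
    have := tendsto_integral_filter_of_dominated_convergence (μ := μ) (l := Filter.atTop)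
      (F := fun (x : ℝ) (p : ℝ × ℝ) => max (p.1 - x / c * p.2) 0) (f := fun _ => 0)
      (fun p => |p.1|) ?_ ?_ hU.abs ?_
    · rwa [integral_zero] at this
    · exact Filter.Eventually.of_forall fun x => (hI x).aestronglyMeasurable
    · filter_upwards [Filter.eventually_ge_atTop 0] with y hy
      filter_upwards [hU0, hV0] with p hp hq
      have : 0 ≤ y / c * p.2 := mul_nonneg (div_nonneg hy hc.le) hq.le
      rw [Real.norm_eq_abs, abs_of_nonneg (le_max_right _ _), abs_of_nonneg hp]
      exact max_le (by linarith) hp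
    · filter_upwards [hV0] with p hq
      refine tendsto_const_nhds.congr' ?_
      filter_upwards [Filter.eventually_ge_atTop (c * p.1 / p.2)] with y hy
      rw [div_le_iff₀ hq] at hy
      have : p.1 ≤ y / c * p.2 := by
        rw [div_mul_eq_mul_div, le_div_iff₀ hc]; linarith
      exact (max_eq_right (by linarith)).symm
  have hzero : Real.exp (-w) ≤ expectedExcess n D 0 := by
    have h1 : expectedExcess n D 0 = ∫ p : ℝ × ℝ, p.1 ∂μ := by
      refine integral_congr_ae ?_
      filter_upwards [hU0] with p hp
      simp [hp]
    rw [h1, hμ, integral_fun_fst (fun u : ℝ => u), integral_id_chiSq]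
    have : Real.exp (-w) ≤ 1 := Real.exp_le_one_iff.2 (by linarith)
    simp only [probReal_univ, one_smul]
    push_cast
    have : (0 : ℝ) ≤ D := Nat.cast_nonneg D
    linarith
  have hlt : ∀ x y : ℝ, x < y → expectedExcess n D x = Real.exp (-w) →
      expectedExcess n D y ≠ Real.exp (-w) := by
    intro x y hxy hx hy
    have hmono : ∀ᵐ p ∂μ, 0 ≤ max (p.1 - x / c * p.2) 0 - max (p.1 - y / c * p.2) 0 := by
      filter_upwards [hV0] with p hq
      have : x / c * p.2 ≤ y / c * p.2 := by gcongr
      exact sub_nonneg.2 (max_le_max_right 0 (by linarith))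
    have hint : ∫ p, (max (p.1 - x / c * p.2) 0 - max (p.1 - y / c * p.2) 0) ∂μ = 0 := by
      rw [integral_sub (hI x) (hI y)]
      exact sub_eq_zero.2 (hx.trans hy.symm)
    have hae := (integral_eq_zero_iff_of_nonneg_ae hmono ((hI x).sub (hI y))).1 hint
    have h0 : expectedExcess n D x = 0 := by
      refine integral_eq_zero_of_ae ?_
      filter_upwards [hae, hV0] with p hp hq
      have hs : x / c * p.2 < y / c * p.2 := by gcongr
      simp only [Pi.zero_apply] at hp ⊢
      by_contra hne
      have hpos : 0 < p.1 - x / c * p.2 := by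
        by_contra hle
        exact hne (max_eq_right (not_lt.1 hle))
      rw [max_eq_left hpos.le] at hp
      have : max (p.1 - y / c * p.2) 0 < p.1 - x / c * p.2 := max_lt (by linarith) hpos
      linarith
    exact (Real.exp_pos (-w)).ne' (hx.symm.trans h0)
  obtain ⟨b, hb, hb0⟩ := ((hlim.eventually (gt_mem_nhds (Real.exp_pos (-w)))).and
    (Filter.eventually_ge_atTop 0)).exists
  obtain ⟨x, hx, hxe⟩ := intermediate_value_Icc' hb0
    (hcont.mono Set.Icc_subset_Ici_self) ⟨hb.le, hzero⟩
  refine ⟨x, ⟨hx.1, hxe⟩, fun y hy => ?_⟩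
  rcases lt_trichotomy x y with h | h | h
  · exact absurd hy.2 (hlt x y h hxe)
  · exact h.symm
  · exact absurd hxe (hlt y x h hy.2)

/-- `penDelta` is nonnegative and solves its defining equation. -/
theorem penDelta_spec {n D : ℕ} (hD : D + 2 ≤ n) {w : ℝ} (hw : 0 ≤ w) :
    0 ≤ penDelta n D w ∧ expectedExcess n D (penDelta n D w) = Real.exp (-w) := by
  obtain ⟨x, hx, hu⟩ := existsUnique_penDelta hD hw
  have : {x : ℝ | 0 ≤ x ∧ expectedExcess n D x = Real.exp (-w)} = {x} :=
    Set.eq_singleton_iff_unique_mem.2 ⟨hx, fun y hy => hu y hy⟩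
  rw [penDelta, this, csInf_singleton]
  exact hx

end

end ConvexAggregation

/-! Write `y = f + e`, let `h` be the selected combination and `S` a model attaining the minimum in
`crit` at `h`. Minimality bounds the criterion at `h` by its value for any fixed convex combination
`g` and any fixed model `m`. Expanding the squares cancels `‖e‖ ^ 2`. Because `S` depends on the
noise, the cross term at `h` is not centred. It is absorbed by Cauchy–Schwarz at the price of `1.1 *
‖Π_T e‖ ^ 2`, where `T ⊇ S` contains `f` and has dimension `dim S + 1`. The penalty compensates this
up to the positive part of `‖Π_T e‖ ^ 2 - t * ‖e - Π_T e‖ ^ 2`, with `t = pen_Δ(S) / (n - dim S)`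
(`norm_sub_sq_le_of_crit_le`).

By Cochran's theorem the two squared norms, divided by `σ ^ 2`, are independent chi-squared
variables with the degrees of freedom of the equation defining `pen_Δ`. The excess thus has
expectation `σ ^ 2 * exp (-Δ)`, and summing over all models costs at most `2 * σ ^ 2`
(`sum_exp_neg_weight_le`). On the side of `g` and `m` the cross term has mean zero, and a Chernoff
bound shows that `pen_Δ` is of order `Δ` (`penDelta_le`). This gives the oracle inequality
`integral_norm_sub_combo_sq_le`.

It remains to choose `m`. With `a = √n L`, Maurey's lemma approximates `g` by a model with `k`
generators up to `a ^ 2 * σ ^ 2 / k`, while the weight is at most about `k * log (eM / k)`.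
Balancing the two gives the rate (`exists_balanced_card`, `exists_model_approx`). -/

namespace ConvexAggregation

/-! ### Sparse approximation in convex hulls. -/

section Maurey

variable {E ι : Type*} [NormedAddCommGroup E] [InnerProductSpace ℝ E] [Fintype ι]

/-- Some index does at least as well as the average over a convex combination. -/
lemma exists_norm_add_sub_sq_le (φ : ι → E) {R : ℝ} (hφ : ∀ j, ‖φ j‖ ≤ R) {l : ι → ℝ}
    (hl : l ∈ stdSimplex ℝ ι) (v : E) :
    ∃ j, ‖v + (φ j - ∑ i, l i • φ i)‖ ^ 2 ≤ ‖v‖ ^ 2 + R ^ 2 := by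
  set g := ∑ i, l i • φ i with hg
  -- The average over `j` with weights `l j` is `‖v‖ ^ 2` plus the variance `∑ l j * ‖φ j‖ ^ 2 - ‖g‖
  -- ^ 2 ≤ R ^ 2`, since `φ j - g` averages to zero; not every term can exceed this.
  by_contra! h
  have hexp : ∀ j, ‖v + (φ j - g)‖ ^ 2
      = ‖v - g‖ ^ 2 + 2 * inner ℝ (v - g) (φ j) + ‖φ j‖ ^ 2 := fun j => by
    rw [← norm_add_sq_real]; congr 2; abel
  have hlow : ‖v‖ ^ 2 + R ^ 2 < ∑ j, l j * ‖v + (φ j - g)‖ ^ 2 := by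
    obtain ⟨j, -, hj⟩ : ∃ j ∈ Finset.univ, 0 < l j := by
      by_contra! h0
      have := Finset.sum_nonpos h0
      rw [hl.2] at this
      linarith
    calc ‖v‖ ^ 2 + R ^ 2 = ∑ j, l j * (‖v‖ ^ 2 + R ^ 2) := by rw [← Finset.sum_mul, hl.2, one_mul]
      _ < _ := Finset.sum_lt_sum (fun i _ => mul_le_mul_of_nonneg_left (h i).le (hl.1 i))
        ⟨j, Finset.mem_univ _, mul_lt_mul_of_pos_left (h j) hj⟩
  have hinner : ∑ j, l j * inner ℝ (v - g) (φ j) = inner ℝ (v - g) g := by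
    rw [hg, inner_sum]
    simp_rw [real_inner_smul_right]
  have hsq : ∑ j, l j * ‖φ j‖ ^ 2 ≤ R ^ 2 := by
    calc ∑ j, l j * ‖φ j‖ ^ 2 ≤ ∑ j, l j * R ^ 2 :=
          Finset.sum_le_sum fun j _ => mul_le_mul_of_nonneg_left
            (pow_le_pow_left₀ (norm_nonneg _) (hφ j) 2) (hl.1 j)
      _ = R ^ 2 := by rw [← Finset.sum_mul, hl.2, one_mul]
  have hsum : ∑ j, l j * ‖v + (φ j - g)‖ ^ 2
      = ‖v - g‖ ^ 2 + 2 * inner ℝ (v - g) g + ∑ j, l j * ‖φ j‖ ^ 2 := by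
    calc ∑ j, l j * ‖v + (φ j - g)‖ ^ 2
        = (∑ j, l j) * ‖v - g‖ ^ 2 + 2 * (∑ j, l j * inner ℝ (v - g) (φ j))
          + ∑ j, l j * ‖φ j‖ ^ 2 := by
          rw [Finset.sum_mul, Finset.mul_sum, ← Finset.sum_add_distrib, ← Finset.sum_add_distrib]
          exact Finset.sum_congr rfl fun j _ => by rw [hexp]; ring
      _ = _ := by rw [hl.2, hinner, one_mul]
  have hv : ‖v - g‖ ^ 2 + 2 * inner ℝ (v - g) g + ‖g‖ ^ 2 = ‖v‖ ^ 2 := by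
    rw [← norm_add_sq_real, sub_add_cancel]
  nlinarith [sq_nonneg ‖g‖]

/-- Maurey's empirical method, without normalization. -/
lemma exists_finset_norm_sub_smul_sq_le (φ : ι → E) {R : ℝ} (hφ : ∀ j, ‖φ j‖ ≤ R)
    {l : ι → ℝ} (hl : l ∈ stdSimplex ℝ ι) (k : ℕ) :
    ∃ m : Finset ι, m.card ≤ k ∧ ∃ s ∈ Submodule.span ℝ (φ '' (m : Set ι)),
      ‖s - (k : ℝ) • ∑ j, l j • φ j‖ ^ 2 ≤ k * R ^ 2 := by
  classical
  induction k with
  | zero => exact ⟨∅, by simp, 0, by simp, by simp⟩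
  | succ k ih =>
    obtain ⟨m, hm, s, hs, hsk⟩ := ih
    -- Greedy form of the random draw: each new vector raises the squared error of the unnormalized
    -- sum by at most `R ^ 2`.
    obtain ⟨j, hj⟩ := exists_norm_add_sub_sq_le φ hφ hl (s - (k : ℝ) • ∑ j, l j • φ j)
    refine ⟨insert j m, (Finset.card_insert_le _ _).trans (by omega), s + φ j, ?_, ?_⟩
    · refine Submodule.add_mem _ (Submodule.span_mono ?_ hs) (Submodule.subset_span ?_)
      · exact Set.image_mono (by simp)
      · exact Set.mem_image_of_mem _ (by simp)
    · have : s + φ j - ((k + 1 : ℕ) : ℝ) • ∑ j, l j • φ j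
          = s - (k : ℝ) • ∑ j, l j • φ j + (φ j - ∑ j, l j • φ j) := by
        push_cast; rw [add_smul, one_smul]; abel
      rw [this]
      push_cast
      linarith

/-- Maurey's lemma: a convex combination of vectors of norm at most `R` is at squared distance at
most `R ^ 2 / k` from the span of `k` of them. -/
lemma exists_finset_card_eq_norm_sub_sq_le (φ : ι → E) {R : ℝ} (hφ : ∀ j, ‖φ j‖ ≤ R)
    {l : ι → ℝ} (hl : l ∈ stdSimplex ℝ ι) {k : ℕ} (hk : 0 < k) (hkι : k ≤ Fintype.card ι) :
    ∃ m : Finset ι, m.card = k ∧ ∃ s ∈ Submodule.span ℝ (φ '' (m : Set ι)),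
      ‖∑ j, l j • φ j - s‖ ^ 2 ≤ R ^ 2 / k := by
  obtain ⟨m, hm, s, hs, h⟩ := exists_finset_norm_sub_smul_sq_le φ hφ hl k
  -- The greedy choice may repeat indices; padding makes the cardinality exactly `k`.
  obtain ⟨m', hmm', hm'⟩ := Finset.exists_superset_card_eq hm hkι
  have hk0 : (0 : ℝ) < k := by exact_mod_cast hk
  refine ⟨m', hm', (k : ℝ)⁻¹ • s, Submodule.smul_mem _ _
    (Submodule.span_mono (Set.image_mono (by exact_mod_cast hmm')) hs), ?_⟩
  have : ∑ j, l j • φ j - (k : ℝ)⁻¹ • s = -((k : ℝ)⁻¹ • (s - (k : ℝ) • ∑ j, l j • φ j)) := by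
    rw [smul_sub, smul_smul, inv_mul_cancel₀ hk0.ne', one_smul]; abel
  rw [this, norm_neg, norm_smul, mul_pow, norm_inv, Real.norm_of_nonneg hk0.le, inv_pow,
    inv_mul_le_iff₀ (by positivity)]
  calc _ ≤ _ := h
    _ = _ := by field_simp

end Maurey

/-! ### Exponential moments of chi-squared variables and size of the penalty. -/

section ChiSquare

lemma integrable_exp_mul_sq_gaussianReal {s : ℝ} (hs : s < 1 / 2) :
    Integrable (fun z : ℝ => Real.exp (s * z ^ 2)) (gaussianReal 0 1) := by
  rw [gaussianReal_of_var_ne_zero _ one_ne_zero,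
    integrable_withDensity_iff (measurable_gaussianPDF _ _) (by simp [gaussianPDF])]
  refine ((integrable_exp_neg_mul_sq (b := 1 / 2 - s) (by linarith)).mul_const
    (√(2 * Real.pi))⁻¹).congr (Filter.Eventually.of_forall fun z => ?_)
  beta_reduce
  rw [toReal_gaussianPDF]
  simp only [gaussianPDFReal, NNReal.coe_one, mul_one, sub_zero]
  rw [mul_left_comm, ← Real.exp_add, mul_comm]
  congr 2; ring

lemma integral_exp_mul_sq_gaussianReal {s : ℝ} (hs : s < 1 / 2) :
    ∫ z : ℝ, Real.exp (s * z ^ 2) ∂(gaussianReal 0 1) = (√(1 - 2 * s))⁻¹ := by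
  rw [integral_gaussianReal_eq_integral_smul one_ne_zero]
  have : ∀ z : ℝ, gaussianPDFReal 0 1 z • Real.exp (s * z ^ 2)
      = (√(2 * Real.pi))⁻¹ * Real.exp (-(1 / 2 - s) * z ^ 2) := fun z => by
    simp only [gaussianPDFReal, NNReal.coe_one, mul_one, sub_zero, smul_eq_mul]
    rw [mul_assoc, ← Real.exp_add]
    congr 2; ring
  simp_rw [this]
  rw [integral_const_mul, integral_gaussian, ← Real.sqrt_inv, ← Real.sqrt_inv,
    ← Real.sqrt_mul (by positivity)]
  congr 1
  have : 1 - 2 * s ≠ 0 := by linarith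
  have : 1 / 2 - s ≠ 0 := by linarith
  have := Real.pi_ne_zero
  field_simp

lemma integrable_exp_mul_chiSq {s : ℝ} (hs : s < 1 / 2) (k : ℕ) :
    Integrable (fun u : ℝ => Real.exp (s * u)) (chiSq k) := by
  unfold chiSq
  rw [integrable_map_measure (by fun_prop) (measurable_sumSq k).aemeasurable]
  refine (Integrable.fintype_prod (f := fun (_ : Fin k) (z : ℝ) => Real.exp (s * z ^ 2))
    fun _ => integrable_exp_mul_sq_gaussianReal hs).congr (Filter.Eventually.of_forall fun z => ?_)
  simp [Finset.mul_sum, Real.exp_sum]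

lemma integral_exp_mul_chiSq {s : ℝ} (hs : s < 1 / 2) (k : ℕ) :
    ∫ u : ℝ, Real.exp (s * u) ∂(chiSq k) = (√(1 - 2 * s))⁻¹ ^ k := by
  unfold chiSq
  rw [integral_map (measurable_sumSq k).aemeasurable (by fun_prop)]
  simp_rw [Finset.mul_sum, Real.exp_sum]
  rw [integral_fintype_prod_eq_prod (fun (_ : Fin k) (z : ℝ) => Real.exp (s * z ^ 2))]
  simp [integral_exp_mul_sq_gaussianReal hs]

lemma integrable_max_chiSq_prod (k k' : ℕ) (t : ℝ) :
    Integrable (fun p : ℝ × ℝ => max (p.1 - t * p.2) 0) ((chiSq k).prod (chiSq k')) :=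
  (((integrable_id_chiSq _).comp_fst _).sub
    (((integrable_id_chiSq _).comp_snd _).const_mul _)).pos_part

/-- Chernoff-type bound for the excess of a chi-squared variable over a multiple of another one. -/
lemma integral_max_chiSq_prod_le (k k' : ℕ) {z : ℝ} (hz : 0 ≤ z) :
    ∫ p : ℝ × ℝ, max (p.1 - 2 * (Real.exp z - 1) * p.2) 0 ∂((chiSq k).prod (chiSq k'))
      ≤ Real.exp (1 + k / 2 - z * k' / 2) := by
  set t := 2 * (Real.exp z - 1) with ht
  have h1z : 1 ≤ Real.exp z := Real.one_le_exp hz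
  have h4 : (1 : ℝ) / 4 < 1 / 2 := by norm_num
  have ht4 : -(t / 4) < 1 / 2 := by linarith
  -- This is `x ≤ 4 * exp (x / 4 - 1)`, that is `1 + u ≤ exp u` at `u = x / 4 - 1`. The choice of
  -- `t` makes `1 + t / 2 = exp z`, so the Laplace transform of the second variable is a pure
  -- exponential.
  have hle : ∀ p : ℝ × ℝ, max (p.1 - t * p.2) 0
      ≤ 4 * Real.exp (-1) * (Real.exp (1 / 4 * p.1) * Real.exp (-(t / 4) * p.2)) := fun p => by
    refine max_le ?_ (by positivity)
    have := Real.add_one_le_exp (1 / 4 * p.1 + -(t / 4) * p.2 - 1)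
    rw [mul_assoc (4 : ℝ), ← Real.exp_add, ← Real.exp_add,
      show -1 + (1 / 4 * p.1 + -(t / 4) * p.2) = 1 / 4 * p.1 + -(t / 4) * p.2 - 1 by ring]
    linarith
  have hint := (integrable_exp_mul_chiSq h4 k).mul_prod (integrable_exp_mul_chiSq ht4 k')
  refine (integral_mono (integrable_max_chiSq_prod k k' t) (hint.const_mul _) hle).trans ?_
  rw [integral_const_mul, integral_prod_mul (fun u : ℝ => Real.exp (1 / 4 * u))
    (fun u : ℝ => Real.exp (-(t / 4) * u)), integral_exp_mul_chiSq h4, integral_exp_mul_chiSq ht4]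
  have e1 : (√(1 - 2 * (1 / 4) : ℝ))⁻¹ ^ k ≤ Real.exp (k / 2) := by
    have : Real.exp ((k : ℝ) / 2) = (Real.exp (1 / 2)) ^ k := by
      rw [← Real.exp_nat_mul]; ring_nf
    rw [this]
    refine pow_le_pow_left₀ (by positivity) ?_ k
    rw [← Real.sqrt_inv, Real.sqrt_le_left (Real.exp_pos _).le, ← Real.exp_nat_mul]
    norm_num
    linarith [Real.add_one_le_exp (1 : ℝ)]
  have e2 : (√(1 - 2 * (-(t / 4))))⁻¹ ^ k' = Real.exp (-(z * k' / 2)) := by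
    have : (1 - 2 * (-(t / 4))) = Real.exp (z / 2) ^ 2 := by
      rw [← Real.exp_nat_mul, ht]; push_cast; ring_nf
    rw [this, Real.sqrt_sq (Real.exp_pos _).le, ← Real.exp_neg, ← Real.exp_nat_mul]
    ring_nf
  have e3 : 4 * Real.exp (-1) ≤ Real.exp 1 := by
    have h2 : (2 : ℝ) ≤ Real.exp 1 := by linarith [Real.add_one_le_exp (1 : ℝ)]
    rw [Real.exp_neg, ← div_eq_mul_inv, div_le_iff₀ (Real.exp_pos _)]
    nlinarith
  rw [e2, show (1 : ℝ) + k / 2 - z * k' / 2 = 1 + (k / 2 + -(z * k' / 2)) by ring, Real.exp_add,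
    Real.exp_add]
  gcongr

lemma expectedExcess_antitone {n D : ℕ} (hD : D + 2 ≤ n) {x y : ℝ} (hxy : x ≤ y) :
    expectedExcess n D y ≤ expectedExcess n D x := by
  have hc : 0 < (n : ℝ) - D := by
    have : ((D + 2 : ℕ) : ℝ) ≤ n := by exact_mod_cast hD
    push_cast at this; linarith
  refine integral_mono_ae (integrable_max_chiSq_prod _ _ _) (integrable_max_chiSq_prod _ _ _) ?_
  filter_upwards [Measure.quasiMeasurePreserving_snd.ae (chiSq_nonneg _)] with p hp
  have : x / ((n : ℝ) - D) * p.2 ≤ y / ((n : ℝ) - D) * p.2 := by gcongr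
  exact max_le_max_right 0 (by linarith)

/-- The penalty `pen_Δ` is at most of the order of the weight. -/
lemma penDelta_le {n D : ℕ} (hD : D + 2 ≤ n) {w : ℝ} (hw : 1 ≤ w) (hDw : D ≤ w)
    (hwn : w ≤ n - D) : penDelta n D w ≤ 24 * Real.exp 12 * w := by
  have hw0 : 0 ≤ w := by linarith
  obtain ⟨-, hspec⟩ := penDelta_spec hD hw0
  have hc2 : 2 ≤ (n : ℝ) - D := by
    have : ((D + 2 : ℕ) : ℝ) ≤ n := by exact_mod_cast hD
    push_cast at this; linarith
  have hc : 0 < (n : ℝ) - D := by linarith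
  -- Since `n - D - 1 ≥ (n - D) / 2`, the gain `z * (n - D - 1) / 2` is at least `3 * w`, while `1 +
  -- (D + 1) / 2 ≤ 2 * w`; the exponent in the Chernoff bound is then at most `-w`.
  set z := 12 * w / ((n : ℝ) - D) with hz
  have hz0 : 0 ≤ z := by positivity
  have hz12 : z ≤ 12 := by rw [hz, div_le_iff₀ hc]; linarith
  have hzc : z * ((n : ℝ) - D) = 12 * w := by rw [hz, div_mul_cancel₀ _ hc.ne']
  set x := 2 * (Real.exp z - 1) * ((n : ℝ) - D) with hx
  have hx0 : 0 ≤ x := by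
    have := Real.one_le_exp hz0
    have : 0 ≤ Real.exp z - 1 := by linarith
    positivity
  have hxw : x ≤ 24 * Real.exp 12 * w := by
    have h1 : Real.exp z - 1 ≤ z * Real.exp z := by
      have h2 : (1 - z) * Real.exp z ≤ Real.exp (-z) * Real.exp z := by
        gcongr
        linarith [Real.add_one_le_exp (-z)]
      rw [← Real.exp_add, neg_add_cancel, Real.exp_zero] at h2
      linarith
    calc x ≤ 2 * (z * Real.exp z) * ((n : ℝ) - D) := by rw [hx]; gcongr
      _ = 2 * Real.exp z * (z * ((n : ℝ) - D)) := by ring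
      _ = 24 * Real.exp z * w := by rw [hzc]; ring
      _ ≤ _ := by gcongr
  have hex : expectedExcess n D x ≤ Real.exp (-w) := by
    unfold expectedExcess
    rw [hx, mul_div_assoc, div_self hc.ne', mul_one]
    refine (integral_max_chiSq_prod_le _ _ hz0).trans (Real.exp_le_exp.2 ?_)
    have : ((n - D - 1 : ℕ) : ℝ) = (n : ℝ) - D - 1 := by
      rw [Nat.cast_sub (by omega), Nat.cast_sub (by omega), Nat.cast_one]
    rw [this]
    push_cast
    nlinarith
  refine le_trans ?_ hxw
  -- If `x` lay below the penalty, monotonicity would make it a second solution of the defining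
  -- equation.
  by_contra! hlt
  have heq : expectedExcess n D x = Real.exp (-w) :=
    le_antisymm hex (hspec ▸ expectedExcess_antitone hD hlt.le)
  exact hlt.ne ((existsUnique_penDelta hD hw0).unique ⟨hx0, heq⟩ (penDelta_spec hD hw0))

end ChiSquare

end ConvexAggregation

namespace ConvexAggregation

/-! ### Projections of a standard Gaussian vector. -/

section GaussianProjection

variable {E : Type*} [NormedAddCommGroup E] [InnerProductSpace ℝ E] [FiniteDimensional ℝ E]
  [MeasurableSpace E] [BorelSpace E]

/-- Cochran's theorem for a subspace and its orthogonal complement: the squared norms of the two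
projections of a standard Gaussian vector are independent chi-squared variables. -/
lemma map_norm_sq_starProjection_stdGaussian (S : Submodule ℝ E) :
    (stdGaussian E).map
        (fun x => (‖S.starProjection x‖ ^ 2, ‖x - S.starProjection x‖ ^ 2))
      = (chiSq (Module.finrank ℝ S)).prod (chiSq (Module.finrank ℝ Sᗮ)) := by
  set b₁ := stdOrthonormalBasis ℝ S
  set b₂ := stdOrthonormalBasis ℝ Sᗮ
  -- In an orthonormal basis adapted to `S` and `Sᗮ` the two projections use disjoint blocks of
  -- independent coordinates.
  set b := (b₁.prod b₂).map S.orthogonalDecomposition.symm with hb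
  have hbl : ∀ i, b (Sum.inl i) = b₁ i := fun i => by
    simp [hb]
  have hbr : ∀ i, b (Sum.inr i) = b₂ i := fun i => by
    simp [hb]
  have hmp := measurePreserving_sumPiEquivProdPi
    (fun _ : Fin (Module.finrank ℝ S) ⊕ Fin (Module.finrank ℝ Sᗮ) => gaussianReal 0 1)
  have hsum : ∀ x : Fin (Module.finrank ℝ S) ⊕ Fin (Module.finrank ℝ Sᗮ) → ℝ,
      ∑ i, x i • b i = ((∑ i, x (Sum.inl i) • b₁ i : S) : E)
        + ((∑ i, x (Sum.inr i) • b₂ i : Sᗮ) : E) := fun x => by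
    simp [Fintype.sum_sum_type, hbl, hbr]
  have hnorm : ∀ {F : Type _} [NormedAddCommGroup F] [InnerProductSpace ℝ F] {k : ℕ}
      (c : OrthonormalBasis (Fin k) ℝ F) (x : Fin k → ℝ), ‖∑ i, x i • c i‖ ^ 2 = ∑ i, x i ^ 2 := by
    intro F _ _ k c x
    have h := c.orthonormal.inner_sum x x Finset.univ
    rw [real_inner_self_eq_norm_sq] at h
    simp [h, sq]
  rw [stdGaussian_eq_map_pi_orthonormalBasis b, Measure.map_map (by fun_prop) (by fun_prop)]
  unfold chiSq
  rw [Measure.map_prod_map _ _ (measurable_sumSq _) (measurable_sumSq _), ← hmp.map_eq,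
    Measure.map_map (by fun_prop) (by fun_prop)]
  congr 1
  ext x : 1
  have hproj : S.starProjection (∑ i, x i • b i) = ((∑ i, x (Sum.inl i) • b₁ i : S) : E) := by
    rw [hsum, map_add, Submodule.starProjection_eq_self_iff.2 (Submodule.coe_mem _),
      S.starProjection_apply_eq_zero_iff.2 (Submodule.coe_mem _), add_zero]
  simp only [Function.comp_apply, hproj]
  rw [hsum, add_sub_cancel_left, ← Submodule.coe_norm, ← Submodule.coe_norm, hnorm, hnorm]
  rfl

lemma integrable_norm_sq_stdGaussian : Integrable (fun x : E => ‖x‖ ^ 2) (stdGaussian E) :=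
  IsGaussian.memLp_two_id.integrable_norm_pow two_ne_zero

lemma integral_norm_sq_stdGaussian :
    ∫ x : E, ‖x‖ ^ 2 ∂(stdGaussian E) = Module.finrank ℝ E := by
  have h := map_norm_sq_starProjection_stdGaussian (⊤ : Submodule ℝ E)
  have h2 := congrArg (fun μ => ∫ p : ℝ × ℝ, p.1 ∂μ) h
  beta_reduce at h2
  rw [integral_map (by fun_prop) (by fun_prop), integral_fun_fst (fun u : ℝ => u),
    integral_id_chiSq] at h2
  simpa [Submodule.starProjection_eq_self_iff.2 (Submodule.mem_top)] using h2

lemma integral_inner_stdGaussian (v : E) : ∫ x, inner ℝ x v ∂(stdGaussian E) = 0 := by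
  simpa [real_inner_comm] using integral_strongDual_stdGaussian (E := E) (innerSL ℝ v)

/-- The expected excess of the squared norm of a projection is `expectedExcess`. -/
lemma integral_max_starProjection_stdGaussian {n D : ℕ} (hn : Module.finrank ℝ E = n)
    {S : Submodule ℝ E} (hS : Module.finrank ℝ S = D + 1) (x : ℝ) :
    ∫ z, max (‖S.starProjection z‖ ^ 2
        - x / ((n : ℝ) - D) * ‖z - S.starProjection z‖ ^ 2) 0 ∂(stdGaussian E)
      = expectedExcess n D x := by
  have h := map_norm_sq_starProjection_stdGaussian S
  have hS' : Module.finrank ℝ Sᗮ = n - D - 1 := by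
    have := S.finrank_add_finrank_orthogonal
    omega
  rw [hS, hS'] at h
  unfold expectedExcess
  rw [← h, integral_map (by fun_prop) (by fun_prop)]

lemma integrable_max_starProjection_stdGaussian (S : Submodule ℝ E) (t : ℝ) :
    Integrable (fun z => max (‖S.starProjection z‖ ^ 2 - t * ‖z - S.starProjection z‖ ^ 2) 0)
      (stdGaussian E) := by
  have h := integrable_max_chiSq_prod (Module.finrank ℝ S) (Module.finrank ℝ Sᗮ) t
  rw [← map_norm_sq_starProjection_stdGaussian S, integrable_map_measure (by fun_prop)
    (by fun_prop)] at h
  exact h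

end GaussianProjection

/-! ### Deterministic comparison of criteria. -/

section Selection

variable {E : Type*} [NormedAddCommGroup E] [InnerProductSpace ℝ E] [FiniteDimensional ℝ E]

/-- If `f` already lies in `S`, an arbitrary outside vector is adjoined, so that the dimension
always matches the `D + 1` degrees of freedom in `expectedExcess`. -/
lemma exists_submodule_finrank_succ {S : Submodule ℝ E}
    (hS : Module.finrank ℝ S < Module.finrank ℝ E) (f : E) :
    ∃ T : Submodule ℝ E, S ≤ T ∧ f ∈ T ∧ Module.finrank ℝ T = Module.finrank ℝ S + 1 := by
  have key : ∀ v : E, v ∉ S → Module.finrank ℝ ↥(S ⊔ Submodule.span ℝ {v})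
      = Module.finrank ℝ S + 1 := fun v hv => by
    have hv0 : v ≠ 0 := by rintro rfl; exact hv S.zero_mem
    have h1 := Submodule.finrank_sup_add_finrank_inf_eq S (Submodule.span ℝ {v})
    have hdis : S ⊓ Submodule.span ℝ {v} = ⊥ := by
      rw [← disjoint_iff, Submodule.disjoint_span_singleton' hv0]
      exact hv
    rw [hdis, finrank_bot, finrank_span_singleton hv0] at h1
    omega
  by_cases hf : f ∈ S
  · obtain ⟨v, hv⟩ : ∃ v, v ∉ S := by
      by_contra! h
      rw [(Submodule.eq_top_iff' (p := S)).2 h, finrank_top] at hS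
      exact lt_irrefl _ hS
    exact ⟨_, le_sup_left, le_sup_left (a := S) hf, key v hv⟩
  · exact ⟨_, le_sup_left, le_sup_right (a := S) (Submodule.mem_span_singleton_self f), key f hf⟩

lemma norm_sub_starProjection_le {S : Submodule ℝ E} {x y : E} (hy : y ∈ S) :
    ‖x - S.starProjection x‖ ≤ ‖x - y‖ := by
  rw [Submodule.starProjection_minimal]
  exact ciInf_le ⟨0, by rintro _ ⟨z, rfl⟩; positivity⟩ (⟨y, hy⟩ : S)

/-- The deterministic part of the risk bound: comparison of the criterion at the selected point
`h` with model `S` and at an arbitrary point `g` approximated by `q`, for the observation `f + e`. -/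
lemma norm_sub_sq_le_of_crit_le {S T : Submodule ℝ E} (hST : S ≤ T) {f : E} (hf : f ∈ T)
    {e h q : E} {r t : ℝ} (ht : 0 ≤ t)
    (hcrit : ‖f + e - S.starProjection h‖ ^ 2 + 1 / 2 * ‖h - S.starProjection h‖ ^ 2
      + 1.1 * t * ‖f + e - S.starProjection (f + e)‖ ^ 2 ≤ ‖f + e - q‖ ^ 2 + r) :
    1 / 22 * ‖f - h‖ ^ 2 ≤ ‖f - q‖ ^ 2 + r + 2 * inner ℝ e (f - q)
      + 1.1 * max (‖T.starProjection e‖ ^ 2 - t * ‖e - T.starProjection e‖ ^ 2) 0 := by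
  set p := S.starProjection h with hp
  have hpS : p ∈ S := S.starProjection_apply_mem h
  have hexp : ∀ x, ‖f + e - x‖ ^ 2 = ‖f - x‖ ^ 2 + 2 * inner ℝ e (f - x) + ‖e‖ ^ 2 := fun x => by
    rw [show f + e - x = (f - x) + e by abel, norm_add_sq_real, real_inner_comm]
  -- The residual of `f + e` on `S` is `e` minus an element of `T`, hence no shorter than the
  -- residual of `e` on `T`.
  have hres : ‖e - T.starProjection e‖ ≤ ‖f + e - S.starProjection (f + e)‖ := by
    rw [show f + e - S.starProjection (f + e) = e - (S.starProjection (f + e) - f) by abel]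
    exact norm_sub_starProjection_le (T.sub_mem (hST (S.starProjection_apply_mem _)) hf)
  have hres2 : t * ‖e - T.starProjection e‖ ^ 2 ≤ t * ‖f + e - S.starProjection (f + e)‖ ^ 2 := by
    gcongr
  have hin : inner ℝ e (f - p) = inner ℝ (T.starProjection e) (f - p) := by
    rw [T.inner_starProjection_left_eq_right,
      Submodule.starProjection_eq_self_iff.2 (T.sub_mem hf (hST hpS))]
  -- As `1.1 * (10 / 11) = 1`, a share `1 / 11` of `‖f - p‖ ^ 2` survives; halving it in the
  -- triangle inequality `htri` gives `1 / 22`.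
  have hcs : -(2 * inner ℝ e (f - p)) ≤ 10 / 11 * ‖f - p‖ ^ 2 + 1.1 * ‖T.starProjection e‖ ^ 2 := by
    rw [hin]
    have := neg_le_of_abs_le (abs_real_inner_le_norm (T.starProjection e) (f - p))
    nlinarith [sq_nonneg (10 / 11 * ‖f - p‖ - ‖T.starProjection e‖)]
  have hmax := le_max_left (‖T.starProjection e‖ ^ 2 - t * ‖e - T.starProjection e‖ ^ 2) 0
  have htri : ‖f - h‖ ^ 2 ≤ 2 * ‖f - p‖ ^ 2 + 2 * ‖h - p‖ ^ 2 := by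
    have h1 : ‖f - h‖ ≤ ‖f - p‖ + ‖h - p‖ := by
      rw [show f - h = (f - p) - (h - p) by abel]; exact norm_sub_le _ _
    nlinarith [norm_nonneg (f - h), sq_nonneg (‖f - p‖ - ‖h - p‖)]
  rw [hexp p, hexp q] at hcrit
  nlinarith [sq_nonneg ‖f - p‖, sq_nonneg ‖h - p‖]

end Selection

end ConvexAggregation

namespace ConvexAggregation

/-! ### Weights, dimensions and existence of a minimizer. -/

section Models

lemma one_le_log_exp_one_mul {M : ℕ} (hM : 1 ≤ M) : 1 ≤ Real.log (Real.exp 1 * M) := by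
  have h1 : (1 : ℝ) ≤ M := by exact_mod_cast hM
  rw [Real.log_mul (Real.exp_pos 1).ne' (by positivity), Real.log_exp]
  linarith [Real.log_nonneg h1]

lemma card_le_weight {M : ℕ} (m : Finset (Fin M)) : (m.card : ℝ) ≤ weight m :=
  le_add_of_nonneg_right (Real.log_natCast_nonneg _)

lemma choose_card_pos {M : ℕ} (m : Finset (Fin M)) : (0 : ℝ) < M.choose m.card := by
  exact_mod_cast Nat.choose_pos (by simpa using m.card_le_univ)

/-- From `log (M choose k) ≤ k * log M`, the weight is at most `k * log (eM)`, which the cardinality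
cap of the family bounds by `n / 2`. -/
lemma weight_le_half {n M : ℕ} (hM : 1 ≤ M) {m : Finset (Fin M)} (hm : m ∈ modelFamily n M) :
    weight m ≤ n / 2 := by
  have hlog := one_le_log_exp_one_mul hM
  have hM0 : (0 : ℝ) < M := by exact_mod_cast hM
  have h1 : Real.log (M.choose m.card) ≤ m.card * Real.log M := by
    rw [← Real.log_pow]
    exact Real.log_le_log (choose_card_pos m) (by exact_mod_cast Nat.choose_le_pow M m.card)
  have h2 := hm.2
  rw [le_div_iff₀ (by positivity)] at h2
  rw [Real.log_mul (Real.exp_pos 1).ne' hM0.ne', Real.log_exp] at h2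
  unfold weight
  linarith

/-- Rests on `(M choose k) ≤ M ^ k / k!` and `k ^ k / k! ≤ exp k`. -/
lemma weight_le_card_mul_log {M : ℕ} {m : Finset (Fin M)} (hm : m.Nonempty) :
    weight m ≤ m.card + m.card * Real.log (Real.exp 1 * M / m.card) := by
  have hk : (0 : ℝ) < m.card := by exact_mod_cast hm.card_pos
  have h1 : (M.choose m.card : ℝ) ≤ (Real.exp 1 * M / m.card) ^ m.card := by
    refine (Nat.choose_le_pow_div m.card M).trans ?_
    have h := Real.pow_div_factorial_le_exp (m.card : ℝ) hk.le m.card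
    have hf : (0 : ℝ) < m.card.factorial := by exact_mod_cast Nat.factorial_pos _
    rw [div_le_iff₀ hf] at h
    rw [div_pow, mul_pow, ← Real.exp_nat_mul, mul_one, div_le_div_iff₀ hf (by positivity)]
    calc (M : ℝ) ^ m.card * (m.card : ℝ) ^ m.card
        ≤ (M : ℝ) ^ m.card * (Real.exp m.card * m.card.factorial) := by gcongr
      _ = _ := by ring
  unfold weight
  rw [← Real.log_pow]
  linarith [Real.log_le_log (choose_card_pos m) h1]

/-- The logarithmic term of the weight cancels the number of sets of each size `k`, leaving `∑ exp
(-k)`. -/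
lemma sum_exp_neg_weight_le (M : ℕ) : ∑ m : Finset (Fin M), Real.exp (-weight m) ≤ 2 := by
  have h := Finset.sum_powerset_apply_card
    (fun k : ℕ => Real.exp (-((k : ℝ) + Real.log (M.choose k))))
    (x := (Finset.univ : Finset (Fin M)))
  rw [Finset.powerset_univ, Finset.card_univ, Fintype.card_fin] at h
  unfold weight
  rw [h]
  refine le_trans (Finset.sum_le_sum fun k hk => ?_) (sum_geometric_two_le (M + 1))
  have hpos : (0 : ℝ) < M.choose k := by
    exact_mod_cast Nat.choose_pos (by simpa [Nat.lt_succ_iff] using hk)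
  have hhalf : Real.exp (-1) ≤ 1 / 2 := by
    rw [Real.exp_neg, one_div]
    exact inv_anti₀ two_pos (by linarith [Real.add_one_le_exp (1 : ℝ)])
  rw [neg_add, Real.exp_add, ← Real.log_inv, Real.exp_log (by positivity), nsmul_eq_mul]
  calc (M.choose k : ℝ) * (Real.exp (-k) * (M.choose k : ℝ)⁻¹) = Real.exp (-1) ^ k := by
        rw [← Real.exp_nat_mul]; field_simp
    _ ≤ _ := pow_le_pow_left₀ (Real.exp_pos _).le hhalf k

lemma finrank_model_le_card {n M : ℕ} (φ : Fin M → EuclideanSpace ℝ (Fin n))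
    (m : Finset (Fin M)) : Module.finrank ℝ (model φ m) ≤ m.card := by
  classical
  unfold model
  rw [← Finset.coe_image]
  exact (finrank_span_finset_le_card _).trans Finset.card_image_le

/-- Dimensions are at most `n / 2`, which is at most `n - 2` because `n ≥ 4`. This leaves the
variable `V` at least one degree of freedom. -/
lemma finrank_model_add_two_le {n M : ℕ} (hn : 4 ≤ n) (hM : 1 ≤ M)
    (φ : Fin M → EuclideanSpace ℝ (Fin n)) {m : Finset (Fin M)} (hm : m ∈ modelFamily n M) :
    Module.finrank ℝ (model φ m) + 2 ≤ n := by
  have h1 : (Module.finrank ℝ (model φ m) : ℝ) ≤ n / 2 :=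
    (Nat.cast_le.2 (finrank_model_le_card φ m)).trans
      ((card_le_weight m).trans (weight_le_half hM hm))
  have h2 : 2 * Module.finrank ℝ (model φ m) ≤ n := by
    have : (2 : ℝ) * Module.finrank ℝ (model φ m) ≤ n := by linarith
    exact_mod_cast this
  omega

/-- The criterion is a minimum of finitely many continuous functions on a compact simplex. -/
lemma exists_isSelected {n M : ℕ} (hM : 1 ≤ M) (φ : Fin M → EuclideanSpace ℝ (Fin n))
    (hne : (modelFamily n M).Nonempty) (y : EuclideanSpace ℝ (Fin n)) :
    ∃ l, IsSelected φ y l := by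
  have : Nonempty (modelFamily n M) := hne.to_subtype
  have : Fintype (modelFamily n M) := Fintype.ofFinite _
  have hcont : Continuous fun l => crit φ y (combo φ l) := by
    unfold crit combo
    simp_rw [← Finset.inf'_univ_eq_ciInf]
    exact Continuous.finset_inf'_apply _ fun m _ => by fun_prop
  obtain ⟨l, hl, hmin⟩ := (isCompact_stdSimplex ℝ (Fin M)).exists_isMinOn
    ⟨Pi.single ⟨0, hM⟩ 1, single_mem_stdSimplex ℝ _⟩ hcont.continuousOn
  exact ⟨l, hl, hmin⟩

end Models

/-! ### Oracle inequality. -/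

section Risk

/-- The constant in the bound of the penalty by the weight. -/
noncomputable def penConst : ℝ := 24 * Real.exp 12

lemma penConst_pos : 0 < penConst := by unfold penConst; positivity

lemma hasLaw_stdGaussian_noise {n : ℕ} {Ω : Type*} [MeasurableSpace Ω] {P : Measure Ω}
    [IsProbabilityMeasure P] {ε : Fin n → Ω → ℝ} {σ : ℝ} (hσ : 0 < σ)
    (hlaw : ∀ i, HasLaw (ε i) (gaussianReal 0 (Real.toNNReal (σ ^ 2))) P)
    (hind : iIndepFun ε P) :
    HasLaw (fun ω => (WithLp.toLp 2 fun i => σ⁻¹ * ε i ω : EuclideanSpace ℝ (Fin n)))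
      (stdGaussian (EuclideanSpace ℝ (Fin n))) P := by
  have h1 : ∀ i, HasLaw (fun ω => σ⁻¹ * ε i ω) (gaussianReal 0 1) P := fun i => by
    convert gaussianReal_const_mul (hlaw i) σ⁻¹ using 2
    · simp
    · ext
      have := hσ.ne'
      simp [Real.coe_toNNReal _ (sq_nonneg σ), this]
  have h2 : iIndepFun (fun i ω => σ⁻¹ * ε i ω) P :=
    hind.comp (fun _ x => σ⁻¹ * x) fun _ => by fun_prop
  have h3 := iIndepFun.hasLaw_pi h1 h2
  exact HasLaw.fun_comp (X := fun ω i => σ⁻¹ * ε i ω) (Y := WithLp.toLp 2)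
    ⟨by fun_prop, map_pi_eq_stdGaussian⟩ h3

variable {n M : ℕ} {φ : Fin M → EuclideanSpace ℝ (Fin n)}

lemma penalty_mul_varEst (m : Finset (Fin M)) (y : EuclideanSpace ℝ (Fin n)) :
    penalty φ m * varEst (model φ m) y
      = 1.1 * (penDelta n (Module.finrank ℝ (model φ m)) (weight m)
          / ((n : ℝ) - Module.finrank ℝ (model φ m)))
        * ‖y - (model φ m).starProjection y‖ ^ 2 := by
  unfold penalty varEst
  ring

/-- Bound of the penalty term of a fixed model by the residual at any point `q` of the model. -/
lemma exists_penalty_mul_varEst_le (hn : 4 ≤ n) (hM : 1 ≤ M) {m : Finset (Fin M)}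
    (hm : m ∈ modelFamily n M) :
    ∃ ρ : ℝ, 0 ≤ ρ ∧ ρ ≤ 1 ∧ ρ * n ≤ 2 * weight m ∧ ∀ y q : EuclideanSpace ℝ (Fin n),
      q ∈ model φ m → penalty φ m * varEst (model φ m) y ≤ 1.1 * penConst * ρ * ‖y - q‖ ^ 2 := by
  have hD := finrank_model_add_two_le hn hM φ hm
  set D := Module.finrank ℝ (model φ m) with hDdef
  have hwn := weight_le_half hM hm
  have hDw : (D : ℝ) ≤ weight m :=
    (Nat.cast_le.2 (finrank_model_le_card φ m)).trans (card_le_weight m)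
  have hw1 : 1 ≤ weight m :=
    le_trans (by exact_mod_cast hm.1.card_pos) (card_le_weight m)
  have hn4 : (4 : ℝ) ≤ n := by exact_mod_cast hn
  have hc : 0 < (n : ℝ) - D := by linarith
  -- Both `D` and the weight are at most `n / 2`, so `n - D ≥ n / 2`; this yields both bounds on the
  -- ratio.
  refine ⟨weight m / ((n : ℝ) - D), by positivity, by rw [div_le_one hc]; linarith, ?_,
    fun y q hq => ?_⟩
  · rw [div_mul_eq_mul_div, div_le_iff₀ hc]
    nlinarith
  · rw [penalty_mul_varEst, ← hDdef]
    have hpen : penDelta n D (weight m) ≤ penConst * weight m :=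
      penDelta_le hD hw1 hDw (by linarith)
    have hpen0 := (penDelta_spec hD (by linarith : 0 ≤ weight m)).1
    have hpc := penConst_pos
    calc 1.1 * (penDelta n D (weight m) / ((n : ℝ) - D)) * ‖y - (model φ m).starProjection y‖ ^ 2
        ≤ 1.1 * (penConst * weight m / ((n : ℝ) - D)) * ‖y - q‖ ^ 2 := by
          gcongr
          exact norm_sub_starProjection_le hq
      _ = _ := by ring

/-- The pathwise comparison of the selected estimator with a fixed point `q` of a fixed model. -/
lemma exists_norm_sub_sq_le_of_isSelected (hn : 4 ≤ n) (hM : 1 ≤ M)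
    (f : EuclideanSpace ℝ (Fin n)) {m : modelFamily n M}
    {T : modelFamily n M → Submodule ℝ (EuclideanSpace ℝ (Fin n))}
    (hT : ∀ i : modelFamily n M, model φ i ≤ T i) (hfT : ∀ i, f ∈ T i)
    {e : EuclideanSpace ℝ (Fin n)} {l l₀ : Fin M → ℝ} (hl : IsSelected φ (f + e) l)
    (hl₀ : l₀ ∈ stdSimplex ℝ (Fin M)) :
    ∃ i : modelFamily n M, 1 / 22 * ‖f - combo φ l‖ ^ 2
      ≤ ‖f - (model φ m).starProjection (combo φ l₀)‖ ^ 2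
        + (1 / 2 * ‖combo φ l₀ - (model φ m).starProjection (combo φ l₀)‖ ^ 2
          + penalty φ m * varEst (model φ m) (f + e))
        + 2 * inner ℝ e (f - (model φ m).starProjection (combo φ l₀))
        + 1.1 * max (‖(T i).starProjection e‖ ^ 2
          - penDelta n (Module.finrank ℝ (model φ i)) (weight i.1)
            / ((n : ℝ) - Module.finrank ℝ (model φ i)) * ‖e - (T i).starProjection e‖ ^ 2) 0 := by
  have : Nonempty (modelFamily n M) := ⟨m⟩
  obtain ⟨i, hi⟩ := exists_eq_ciInf_of_finite (f := fun m : modelFamily n M =>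
    (‖f + e - (model φ m).starProjection (combo φ l)‖ ^ 2
      + 1 / 2 * ‖combo φ l - (model φ m).starProjection (combo φ l)‖ ^ 2
      + penalty φ m * varEst (model φ m) (f + e)))
  have hmin : crit φ (f + e) (combo φ l) ≤ crit φ (f + e) (combo φ l₀) := hl.2 hl₀
  have hle : crit φ (f + e) (combo φ l₀) ≤ _ := ciInf_le (Set.finite_range _).bddBelow m
  have hcrit := (hi.trans_le hmin).trans hle
  have hD := finrank_model_add_two_le hn hM φ i.2
  have hc : 0 ≤ (n : ℝ) - Module.finrank ℝ (model φ i) := by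
    have : ((Module.finrank ℝ (model φ i) + 2 : ℕ) : ℝ) ≤ n := by exact_mod_cast hD
    push_cast at this; linarith
  have hw : 0 ≤ weight i.1 := (Nat.cast_nonneg _).trans (card_le_weight _)
  refine ⟨i, norm_sub_sq_le_of_crit_le (hT i) (hfT i)
    (div_nonneg (penDelta_spec hD hw).1 hc) ?_⟩
  rw [← penalty_mul_varEst, ← add_assoc]
  exact hcrit

variable {Ω : Type*} [MeasurableSpace Ω] {P : Measure Ω} [IsProbabilityMeasure P]

lemma norm_combo_le {R : ℝ} (hφ : ∀ j, ‖φ j‖ ≤ R) {l : Fin M → ℝ}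
    (hl : l ∈ stdSimplex ℝ (Fin M)) : ‖combo φ l‖ ≤ R := by
  calc ‖combo φ l‖ ≤ ∑ j, l j * ‖φ j‖ := (norm_sum_le _ _).trans_eq
        (Finset.sum_congr rfl fun j _ => by rw [norm_smul, Real.norm_of_nonneg (hl.1 j)])
    _ ≤ ∑ j, l j * R := Finset.sum_le_sum fun j _ => mul_le_mul_of_nonneg_left (hφ j) (hl.1 j)
    _ = R := by rw [← Finset.sum_mul, hl.2, one_mul]

/-- The estimator stays in a bounded convex hull, so its loss is bounded. -/
lemma integrable_norm_sub_combo_sq (f : EuclideanSpace ℝ (Fin n)) {lhat : Ω → Fin M → ℝ}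
    (hmeas : AEMeasurable (fun ω => combo φ (lhat ω)) P)
    (hl : ∀ᵐ ω ∂P, lhat ω ∈ stdSimplex ℝ (Fin M)) :
    Integrable (fun ω => ‖f - combo φ (lhat ω)‖ ^ 2) P := by
  refine Integrable.of_bound (C := (‖f‖ + ∑ j, ‖φ j‖) ^ 2)
    ((hmeas.const_sub f).norm.pow_const 2).aestronglyMeasurable ?_
  filter_upwards [hl] with ω hω
  rw [Real.norm_of_nonneg (by positivity)]
  have := norm_combo_le (φ := φ) (fun j => Finset.single_le_sum (f := fun j => ‖φ j‖)
    (fun _ _ => norm_nonneg _) (Finset.mem_univ j)) hω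
  gcongr
  exact (norm_sub_le _ _).trans (by gcongr)

/-- Oracle inequality for the selected estimator: its risk is controlled by the approximation
error and the weight of every model of the family. -/
lemma integral_norm_sub_combo_sq_le (hn : 4 ≤ n) (hM : 1 ≤ M) {σ : ℝ} (hσ : 0 < σ)
    {f : EuclideanSpace ℝ (Fin n)} {Z : Ω → EuclideanSpace ℝ (Fin n)}
    (hZ : HasLaw Z (stdGaussian (EuclideanSpace ℝ (Fin n))) P) {lhat : Ω → Fin M → ℝ}
    (hmeas : AEMeasurable (fun ω => combo φ (lhat ω)) P)
    (hsel : ∀ᵐ ω ∂P, IsSelected φ (f + σ • Z ω) (lhat ω))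
    {m : Finset (Fin M)} (hm : m ∈ modelFamily n M) {l₀ : Fin M → ℝ}
    (hl₀ : l₀ ∈ stdSimplex ℝ (Fin M)) :
    ∫ ω, ‖f - combo φ (lhat ω)‖ ^ 2 ∂P ≤ 110 * (1 + penConst) * (‖f - combo φ l₀‖ ^ 2
      + ‖combo φ l₀ - (model φ m).starProjection (combo φ l₀)‖ ^ 2 + weight m * σ ^ 2) := by
  have : Fintype (modelFamily n M) := Fintype.ofFinite _
  have hfin : ∀ i : modelFamily n M, Module.finrank ℝ (model φ i) + 2 ≤ n :=
    fun i => finrank_model_add_two_le hn hM φ i.2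
  have hw0 : ∀ m : Finset (Fin M), 0 ≤ weight m :=
    fun m => (Nat.cast_nonneg _).trans (card_le_weight _)
  choose T hT hfT hTfin using fun i : modelFamily n M =>
    exists_submodule_finrank_succ (S := model φ i) (by
      have := hfin i
      rw [finrank_euclideanSpace_fin]; omega) f
  obtain ⟨ρ, hρ0, hρ1, hρn, hpen⟩ := exists_penalty_mul_varEst_le (φ := φ) hn hM hm
  set g := combo φ l₀ with hg
  set q := (model φ m).starProjection g with hq
  set γ := stdGaussian (EuclideanSpace ℝ (Fin n))
  set t : modelFamily n M → ℝ := fun i => penDelta n (Module.finrank ℝ (model φ i)) (weight i.1)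
    / ((n : ℝ) - Module.finrank ℝ (model φ i))
  set ex : modelFamily n M → EuclideanSpace ℝ (Fin n) → ℝ := fun i z =>
    max (‖(T i).starProjection z‖ ^ 2 - t i * ‖z - (T i).starProjection z‖ ^ 2) 0 with hex
  set A : ℝ := ‖f - q‖ ^ 2 + 1 / 2 * ‖g - q‖ ^ 2 + 2.2 * penConst * ρ * ‖f - q‖ ^ 2 with hA
  set c : ℝ := 2.2 * penConst * ρ * σ ^ 2 with hc
  set B : EuclideanSpace ℝ (Fin n) → ℝ := fun z =>
    A + 2 * σ * inner ℝ z (f - q) + c * ‖z‖ ^ 2 + 1.1 * σ ^ 2 * ∑ i, ex i z with hB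
  have hpc := penConst_pos
  have hpath : ∀ᵐ ω ∂P, 1 / 22 * ‖f - combo φ (lhat ω)‖ ^ 2 ≤ B (Z ω) := by
    filter_upwards [hsel] with ω hω
    obtain ⟨i, hi⟩ := exists_norm_sub_sq_le_of_isSelected hn hM f (m := ⟨m, hm⟩) hT hfT hω hl₀
    have hscale : max (‖(T i).starProjection (σ • Z ω)‖ ^ 2
        - t i * ‖σ • Z ω - (T i).starProjection (σ • Z ω)‖ ^ 2) 0 = σ ^ 2 * ex i (Z ω) := by
      rw [hex, map_smul, ← smul_sub, norm_smul, norm_smul, mul_pow, mul_pow,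
        Real.norm_of_nonneg hσ.le, mul_max_of_nonneg _ _ (sq_nonneg σ), mul_zero]
      congr 1; ring
    have hres : ‖f + σ • Z ω - q‖ ^ 2 ≤ 2 * ‖f - q‖ ^ 2 + 2 * (σ ^ 2 * ‖Z ω‖ ^ 2) := by
      have h1 : ‖f + σ • Z ω - q‖ ≤ ‖f - q‖ + σ * ‖Z ω‖ := by
        rw [show f + σ • Z ω - q = (f - q) + σ • Z ω by abel]
        refine (norm_add_le _ _).trans_eq ?_
        rw [norm_smul, Real.norm_of_nonneg hσ.le]
      nlinarith [norm_nonneg (f + σ • Z ω - q), sq_nonneg (‖f - q‖ - σ * ‖Z ω‖)]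
    have hpen' : penalty φ m * varEst (model φ m) (f + σ • Z ω)
        ≤ 1.1 * penConst * ρ * (2 * ‖f - q‖ ^ 2 + 2 * (σ ^ 2 * ‖Z ω‖ ^ 2)) :=
      (hpen _ q ((model φ m).starProjection_apply_mem g)).trans (by gcongr)
    -- The index `i` depends on the noise; summing over all models removes this dependence before
    -- integrating.
    have hsum : ex i (Z ω) ≤ ∑ i, ex i (Z ω) :=
      Finset.single_le_sum (f := fun i => ex i (Z ω)) (fun _ _ => le_max_right _ _)
        (Finset.mem_univ i)
    have hsum' : 1.1 * (σ ^ 2 * ex i (Z ω)) ≤ 1.1 * σ ^ 2 * ∑ i, ex i (Z ω) := by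
      rw [← mul_assoc]; gcongr
    rw [hscale, real_inner_smul_left] at hi
    simp only [hB, hA, hc]
    linarith
  have hexint : ∀ i, Integrable (ex i) γ := fun i =>
    integrable_max_starProjection_stdGaussian (T i) (t i)
  have hexval : ∀ i, ∫ z, ex i z ∂γ = Real.exp (-weight i.1) := fun i =>
    (integral_max_starProjection_stdGaussian finrank_euclideanSpace_fin (hTfin i) _).trans
      (penDelta_spec (hfin i) (hw0 _)).2
  have hinnerint : Integrable (fun z => inner ℝ z (f - q)) γ :=
    (IsGaussian.integrable_id).inner_const (f - q)
  have hI1 : Integrable (fun z => A + 2 * σ * inner ℝ z (f - q)) γ :=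
    (integrable_const A).add (hinnerint.const_mul _)
  have hI2 : Integrable (fun z => A + 2 * σ * inner ℝ z (f - q) + c * ‖z‖ ^ 2) γ :=
    hI1.add (integrable_norm_sq_stdGaussian.const_mul c)
  have hI3 : Integrable (fun z => 1.1 * σ ^ 2 * ∑ i, ex i z) γ :=
    (integrable_finsetSum _ fun i _ => hexint i).const_mul _
  have hBint : Integrable B γ := hI2.add hI3
  have hsumexp : ∑ i : modelFamily n M, Real.exp (-weight i.1) ≤ 2 := by
    refine le_trans ?_ (sum_exp_neg_weight_le M)
    refine (Finset.sum_map Finset.univ (Function.Embedding.subtype (· ∈ modelFamily n M))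
      fun m => Real.exp (-weight m)).symm.trans_le ?_
    exact Finset.sum_le_univ_sum_of_nonneg fun m => (Real.exp_pos _).le
  have hBval : ∫ z, B z ∂γ ≤ A + c * n + 1.1 * σ ^ 2 * 2 := by
    rw [hB, integral_add hI2 hI3,
      integral_add hI1 (integrable_norm_sq_stdGaussian.const_mul c),
      integral_add (integrable_const A) (hinnerint.const_mul _), integral_const_mul,
      integral_const_mul, integral_const_mul, integral_inner_stdGaussian,
      integral_norm_sq_stdGaussian, integral_finsetSum _ fun i _ => hexint i]
    simp only [hexval, integral_const, probReal_univ, one_smul, finrank_euclideanSpace_fin]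
    have : 1.1 * σ ^ 2 * ∑ i : modelFamily n M, Real.exp (-weight i.1) ≤ 1.1 * σ ^ 2 * 2 := by
      gcongr
    linarith
  have hint := integrable_norm_sub_combo_sq f hmeas (hsel.mono fun ω h => h.1)
  have hmain : ∫ ω, 1 / 22 * ‖f - combo φ (lhat ω)‖ ^ 2 ∂P ≤ ∫ z, B z ∂γ := by
    rw [← hZ.integral_comp (f := B) hBint.aestronglyMeasurable]
    refine integral_mono_ae (hint.const_mul _) ?_ hpath
    rw [← hZ.map_eq] at hBint
    exact hBint.comp_aemeasurable hZ.aemeasurable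
  rw [integral_const_mul] at hmain
  have hw1 : 1 ≤ weight m :=
    le_trans (by exact_mod_cast hm.1.card_pos) (card_le_weight m)
  have htri : ‖f - q‖ ^ 2 ≤ 2 * ‖f - g‖ ^ 2 + 2 * ‖g - q‖ ^ 2 := by
    have h1 : ‖f - q‖ ≤ ‖f - g‖ + ‖g - q‖ := norm_sub_le_norm_sub_add_norm_sub _ _ _
    nlinarith [norm_nonneg (f - q), sq_nonneg (‖f - g‖ - ‖g - q‖)]
  have hA' : A ≤ (1 + 2.2 * penConst) * (2 * ‖f - g‖ ^ 2 + 2 * ‖g - q‖ ^ 2)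
      + 1 / 2 * ‖g - q‖ ^ 2 := by
    have h1 : 2.2 * penConst * ρ * ‖f - q‖ ^ 2 ≤ 2.2 * penConst * 1 * ‖f - q‖ ^ 2 := by gcongr
    have h2 : (1 + 2.2 * penConst) * ‖f - q‖ ^ 2
        ≤ (1 + 2.2 * penConst) * (2 * ‖f - g‖ ^ 2 + 2 * ‖g - q‖ ^ 2) := by gcongr
    linarith
  have hc' : c * n ≤ 4.4 * penConst * (weight m * σ ^ 2) := by
    calc c * n = 2.2 * penConst * σ ^ 2 * (ρ * n) := by rw [hc]; ring
      _ ≤ 2.2 * penConst * σ ^ 2 * (2 * weight m) := by gcongr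
      _ = _ := by ring
  have hσw : σ ^ 2 ≤ weight m * σ ^ 2 := le_mul_of_one_le_left (sq_nonneg σ) hw1
  have p1 : 0 ≤ penConst * ‖f - g‖ ^ 2 := by positivity
  have p2 : 0 ≤ penConst * ‖g - q‖ ^ 2 := by positivity
  have p3 : 0 ≤ penConst * (weight m * σ ^ 2) := by
    have := hw0 m
    positivity
  have p4 := sq_nonneg ‖f - g‖
  have p5 := sq_nonneg ‖g - q‖
  have p6 := sq_nonneg σ
  -- Multiplying by `22` gives coefficients at most `55 + 96.8 * penConst`, within `110 * (1 +
  -- penConst)`.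
  linarith

end Risk

/-! ### Balancing approximation against weight. -/

section Tuning

/-- The choice of the model dimension that balances Maurey's approximation error and the weight. -/
lemma exists_balanced_card {a : ℝ} {M : ℕ} (ha : 2 ≤ a) (haM : a ≤ M)
    (hMa : (M : ℝ) ≤ (Real.exp 1)⁻¹ * (a * Real.exp (a ^ 2))) :
    ∃ k : ℕ, 0 < k ∧ (k : ℝ) ≤ a ∧
      a ^ 2 / k ≤ 2 * (a * √(Real.log (Real.exp 1 * M / a))) ∧
      k + k * Real.log (Real.exp 1 * M / k) ≤ 4 * (a * √(Real.log (Real.exp 1 * M / a))) := by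
  have ha0 : 0 < a := by linarith
  have hM0 : (0 : ℝ) < M := by linarith
  have he := Real.exp_pos (1 : ℝ)
  set ℓ := Real.log (Real.exp 1 * M / a) with hℓ
  have hℓ1 : 1 ≤ ℓ := by
    rw [hℓ, Real.le_log_iff_exp_le (by positivity), le_div_iff₀ ha0]
    gcongr
  have hℓa : ℓ ≤ a ^ 2 := by
    rw [hℓ, Real.log_le_iff_le_exp (by positivity), div_le_iff₀ ha0]
    rw [← div_eq_inv_mul, le_div_iff₀ he] at hMa
    linarith
  set s := √ℓ with hs
  have hs1 : 1 ≤ s := Real.one_le_sqrt.2 hℓ1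
  have hs0 : 0 < s := by linarith
  have hss : s * s = ℓ := Real.mul_self_sqrt (by linarith)
  have hsa : s ≤ a := Real.sqrt_le_left ha0.le |>.2 hℓa
  have h1 : 1 ≤ a / s := (one_le_div hs0).2 hsa
  -- Balances `a ^ 2 / k` with `k * ℓ`. The bound `a ≤ M` gives `ℓ ≥ 1`, and the upper bound on `M`
  -- gives `ℓ ≤ a ^ 2`, hence `k ≥ 1`; rounding down costs at most a factor `2`.
  set k := ⌊a / s⌋₊ with hk
  have hk0 : 0 < k := Nat.floor_pos.2 h1
  have hk1 : (1 : ℝ) ≤ k := by exact_mod_cast hk0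
  have hk0' : (0 : ℝ) < k := by linarith
  have hks : k * s ≤ a := (le_div_iff₀ hs0).1 (Nat.floor_le (by positivity))
  have hak : a ≤ 2 * (k * s) := by
    have := (Nat.lt_floor_add_one (a / s)).le
    rw [div_le_iff₀ hs0, ← hk] at this
    nlinarith
  have hka : (k : ℝ) ≤ a := by nlinarith
  refine ⟨k, hk0, hka, ?_, ?_⟩
  · rw [div_le_iff₀ hk0']
    nlinarith
  · have hsplit : Real.log (Real.exp 1 * M / k) = ℓ + Real.log (a / k) := by
      rw [hℓ, ← Real.log_mul (by positivity) (by positivity)]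
      congr 1; field_simp
    have hlog : k * Real.log (a / k) ≤ a := by
      have := Real.log_le_sub_one_of_pos (div_pos ha0 hk0')
      calc k * Real.log (a / k) ≤ k * (a / k) := by gcongr; linarith
        _ = a := by field_simp
    have hkl : k * ℓ ≤ a * s := by rw [← hss]; nlinarith
    have has : a ≤ a * s := le_mul_of_one_le_right ha0.le hs1
    rw [hsplit, mul_add]
    linarith

end Tuning

end ConvexAggregation

namespace ConvexAggregation

/-! ### Consequences of (HM) and the final bound. -/

section Aggregation

variable {n M : ℕ} {φ : Fin M → EuclideanSpace ℝ (Fin n)} {σ : ℝ}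

lemma norm_le_ratioL_mul (hn : 0 < n) (hσ : 0 < σ) (j : Fin M) :
    ‖φ j‖ ≤ √(n : ℝ) * ratioL φ σ * σ := by
  have hn' : (0 : ℝ) < √(n : ℝ) := Real.sqrt_pos.2 (by exact_mod_cast hn)
  have h : ‖φ j‖ / (σ * √(n : ℝ)) ≤ ratioL φ σ :=
    le_ciSup (f := fun j => ‖φ j‖ / (σ * √(n : ℝ))) (Set.finite_range _).bddAbove j
  rw [div_le_iff₀ (by positivity)] at h
  linarith

lemma ratioL_nonneg (hσ : 0 < σ) : 0 ≤ ratioL φ σ :=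
  Real.iSup_nonneg fun _ => by positivity

/-- The second term of the minimum in (HM) says `log (eM) ≤ √n / (2L)`. Any `k ≤ √n L` is therefore
an admissible cardinality. -/
lemma CondHM.le_div_log {L : ℝ} (h : CondHM n M L) (hL : 0 ≤ L) (hM : 1 ≤ M) :
    √(n : ℝ) * L ≤ n / (2 * Real.log (Real.exp 1 * M)) := by
  obtain ⟨h2, -, hmin⟩ := h
  have hlog := one_le_log_exp_one_mul hM
  have hM0 : (0 : ℝ) < M := by exact_mod_cast hM
  have hL0 : 0 < L := by
    refine hL.lt_of_ne fun h => ?_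
    rw [← h, mul_zero] at h2
    linarith
  have hle := hmin.trans (mul_le_mul_of_nonneg_left (min_le_right _ _) (by positivity))
  rw [← div_eq_inv_mul, le_div_iff₀ (Real.exp_pos _), mul_comm,
    ← Real.log_le_iff_le_exp (by positivity), le_div_iff₀ (by positivity)] at hle
  rw [le_div_iff₀ (by positivity)]
  calc √(n : ℝ) * L * (2 * Real.log (Real.exp 1 * M))
      = √(n : ℝ) * (Real.log (Real.exp 1 * M) * (2 * L)) := by ring
    _ ≤ √(n : ℝ) * √(n : ℝ) := by gcongr
    _ = n := Real.mul_self_sqrt (Nat.cast_nonneg _)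

/-- Every convex combination is well approximated by some model of the family, with a balance
between approximation error and weight. -/
lemma exists_model_approx (hn : 0 < n) (hM : 1 ≤ M) (hσ : 0 < σ) (h : CondHM n M (ratioL φ σ))
    {l : Fin M → ℝ} (hl : l ∈ stdSimplex ℝ (Fin M)) :
    ∃ m ∈ modelFamily n M,
      ‖combo φ l - (model φ m).starProjection (combo φ l)‖ ^ 2 + weight m * σ ^ 2
        ≤ 6 * (√(n : ℝ) * ratioL φ σ * √(Real.log (Real.exp 1 * M / (√(n : ℝ) * ratioL φ σ))))
          * σ ^ 2 := by
  set a := √(n : ℝ) * ratioL φ σ with ha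
  have hMa : (M : ℝ) ≤ (Real.exp 1)⁻¹ * (a * Real.exp (a ^ 2)) := by
    rw [ha, mul_pow, Real.sq_sqrt (Nat.cast_nonneg n)]
    exact h.2.2.trans (mul_le_mul_of_nonneg_left (min_le_left _ _) (by positivity))
  obtain ⟨k, hk0, hka, hk1, hk2⟩ := exists_balanced_card h.1 h.2.1 hMa
  have hkM : k ≤ M := by exact_mod_cast hka.trans h.2.1
  obtain ⟨m, hmk, s, hs, hms⟩ := exists_finset_card_eq_norm_sub_sq_le φ
    (norm_le_ratioL_mul hn hσ) hl hk0 (by simpa using hkM)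
  have hne : m.Nonempty := Finset.card_pos.1 (hmk ▸ hk0)
  refine ⟨m, ⟨hne, ?_⟩, ?_⟩
  · rw [hmk]
    exact hka.trans (h.le_div_log (ratioL_nonneg hσ) hM)
  · have hw := weight_le_card_mul_log hne
    rw [hmk] at hw
    have hproj : ‖combo φ l - (model φ m).starProjection (combo φ l)‖ ^ 2 ≤ a ^ 2 / k * σ ^ 2 := by
      calc _ ≤ ‖combo φ l - s‖ ^ 2 := by
            gcongr
            exact norm_sub_starProjection_le hs
        _ ≤ (a * σ) ^ 2 / k := hms
        _ = _ := by ring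
    -- The constant is `6 = 2 + 4`: approximation error plus weight.
    nlinarith [sq_nonneg σ]

end Aggregation

end ConvexAggregation

theorem proposition2 :
    ∃ C : ℝ, 1 < C ∧
      ∀ (n M : ℕ) (σ : ℝ) (f : EuclideanSpace ℝ (Fin n)) (φ : Fin M → EuclideanSpace ℝ (Fin n)),
        4 ≤ n → 2 ≤ M → 0 < σ → ConvexAggregation.CondHM n M (ConvexAggregation.ratioL φ σ) →
        (∀ y : EuclideanSpace ℝ (Fin n), ∃ l, ConvexAggregation.IsSelected φ y l) ∧
        ∀ {Ω : Type*} [MeasurableSpace Ω] (P : Measure Ω) [IsProbabilityMeasure P]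
          (ε : Fin n → Ω → ℝ),
          (∀ i, HasLaw (ε i) (gaussianReal 0 (Real.toNNReal (σ ^ 2))) P) → iIndepFun ε P →
          ∀ lhat : Ω → Fin M → ℝ,
            AEMeasurable (fun ω => ConvexAggregation.combo φ (lhat ω)) P →
            (∀ᵐ ω ∂P, ConvexAggregation.IsSelected φ
              (ConvexAggregation.observation f ε ω) (lhat ω)) →
            Integrable (fun ω => ‖f - ConvexAggregation.combo φ (lhat ω)‖ ^ 2) P ∧
            (∫ ω, ‖f - ConvexAggregation.combo φ (lhat ω)‖ ^ 2 ∂P)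
                - C * ⨅ g : ConvexAggregation.combo φ '' stdSimplex ℝ (Fin M),
                    ‖f - (g : EuclideanSpace ℝ (Fin n))‖ ^ 2
              ≤ C * √(n * ConvexAggregation.ratioL φ σ ^ 2 *
                    Real.log (Real.exp 1 * M / √(n * ConvexAggregation.ratioL φ σ ^ 2))) * σ ^ 2 := by
  have hpc := ConvexAggregation.penConst_pos
  set C₁ : ℝ := 110 * (1 + ConvexAggregation.penConst) with hC₁
  have hC₁0 : 1 < C₁ := by rw [hC₁]; linarith
  refine ⟨6 * C₁, by linarith, fun n M σ f φ hn hM hσ hHM => ⟨fun y => ?_, ?_⟩⟩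
  · have hM1 : 1 ≤ M := by omega
    -- A vertex of the simplex serves only to show that the family of models is nonempty.
    obtain ⟨m, hm, -⟩ := ConvexAggregation.exists_model_approx (φ := φ) (by omega) hM1 hσ hHM
      (single_mem_stdSimplex ℝ (⟨0, hM1⟩ : Fin M))
    exact ConvexAggregation.exists_isSelected hM1 φ ⟨m, hm⟩ y
  intro Ω _ P _ ε hlaw hind lhat hmeas hsel
  have hM1 : 1 ≤ M := by omega
  refine ⟨ConvexAggregation.integrable_norm_sub_combo_sq f hmeas (hsel.mono fun ω h => h.1), ?_⟩
  have hL0 := ConvexAggregation.ratioL_nonneg (φ := φ) hσ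
  have hsqrt : √((n : ℝ) * ConvexAggregation.ratioL φ σ ^ 2)
      = √(n : ℝ) * ConvexAggregation.ratioL φ σ := by
    rw [Real.sqrt_mul (Nat.cast_nonneg n), Real.sqrt_sq hL0]
  rw [Real.sqrt_mul (by positivity), hsqrt]
  set r := √(n : ℝ) * ConvexAggregation.ratioL φ σ
    * √(Real.log (Real.exp 1 * M / (√(n : ℝ) * ConvexAggregation.ratioL φ σ)))
  have hsel' : ∀ᵐ ω ∂P, ConvexAggregation.IsSelected φ
      (f + σ • (WithLp.toLp 2 fun i => σ⁻¹ * ε i ω : EuclideanSpace ℝ (Fin n))) (lhat ω) := by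
    filter_upwards [hsel] with ω hω
    convert hω using 1
    unfold ConvexAggregation.observation
    congr 1
    ext i
    simp [hσ.ne']
  have hbound : ∀ l ∈ stdSimplex ℝ (Fin M),
      ∫ ω, ‖f - ConvexAggregation.combo φ (lhat ω)‖ ^ 2 ∂P
        ≤ 6 * C₁ * ‖f - ConvexAggregation.combo φ l‖ ^ 2 + 6 * C₁ * r * σ ^ 2 := by
    intro l hl
    obtain ⟨m, hm, happrox⟩ := ConvexAggregation.exists_model_approx (by omega) hM1 hσ hHM hl
    have horacle := ConvexAggregation.integral_norm_sub_combo_sq_le hn hM1 hσ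
      (ConvexAggregation.hasLaw_stdGaussian_noise hσ hlaw hind) hmeas hsel' hm hl
    have h1 := mul_le_mul_of_nonneg_left happrox (by linarith : 0 ≤ C₁)
    have h2 : 0 ≤ C₁ * ‖f - ConvexAggregation.combo φ l‖ ^ 2 := by positivity
    linarith
  have : Nonempty (ConvexAggregation.combo φ '' stdSimplex ℝ (Fin M)) :=
    ⟨_, Set.mem_image_of_mem _ (single_mem_stdSimplex ℝ (⟨0, hM1⟩ : Fin M))⟩
  -- Isolating the squared distance turns the bound for each combination into a lower bound for the
  -- infimum.
  have hinf : ((∫ ω, ‖f - ConvexAggregation.combo φ (lhat ω)‖ ^ 2 ∂P) - 6 * C₁ * r * σ ^ 2)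
      / (6 * C₁) ≤ ⨅ g : ConvexAggregation.combo φ '' stdSimplex ℝ (Fin M),
        ‖f - (g : EuclideanSpace ℝ (Fin n))‖ ^ 2 := by
    refine le_ciInf ?_
    rintro ⟨_, l, hl, rfl⟩
    rw [div_le_iff₀ (by positivity)]
    linarith [hbound l hl]
  rw [div_le_iff₀ (by positivity)] at hinf
  linarith
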